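/- For an integral domain $R$ with quotient field $K$, call $R$ a valuative domain if for each $x\in K$ at least one of the extensions $R\subseteq R[x]$, $R\subseteq R[x^{-1}]$ has no ring strictly between its two members (for $x=0$ the condition holds trivially, since $R[0]=R$). Call $R$ a maximal non valuative domain if $R\neq K$, $R$ is not a valuative domain, and every subring of $K$ properly containing $R$ is a valuative domain. Let $R$ be an integrally closed maximal non valuative domain. Then the following hold. (i) The number of maximal ideals of $R$ satisfies $2\le|\mathrm{Max}(R)|\le 4$. (ii) If $|\mathrm{Max}(R)|=2$, then there are exactly two non-maximal prime ideals of $R$ that are not comparable under inclusion; that is, there is exactly one unordered pair $\{P,Q\}$ of non-maximal prime ideals of $R$ with $P\not\subseteq Q$ and $Q\not\subseteq P$. If $|\mathrm{Max}(R)|\neq 2$, then the set of non-maximal prime ideals of $R$ is linearly ordered by inclusion. (iii) There are at most two maximal ideals $M$ of $R$ such that $M$ does not contain all non-maximal prime ideals of $R$. -/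

import Mathlib

/-- There is no ring strictly between `R` and `T`, where `T` is an `R`-subalgebra of an
`R`-algebra `A`; the possibility `T = R` (that is, `T = ⊥`) is allowed. The `R`-subalgebras of
an extension ring `A` of `R` are the subrings of `A` containing `R`. -/
def HasNoIntermediateRing {R A : Type*} [CommRing R] [CommRing A] [Algebra R A]
    (T : Subalgebra R A) : Prop :=
  ∀ S : Subalgebra R A, S ≤ T → S = ⊥ ∨ S = T

/-- A domain `R` is valuative if for each `x` in its quotient field, at least one of
`R ⊆ R[x]` and `R ⊆ R[x⁻¹]` has no intermediate ring. (For `x = 0` we have `R[x] = R`, so that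
the condition holds whatever is meant by `x⁻¹`.) -/
def IsValuativeDomain (R : Type*) [CommRing R] [IsDomain R] : Prop :=
  ∀ x : FractionRing R,
    HasNoIntermediateRing (Algebra.adjoin R {x}) ∨
      HasNoIntermediateRing (Algebra.adjoin R {x⁻¹})

/-- A domain `R` is a maximal non valuative domain if it is a proper subring of its quotient
field, it is not valuative, and every subring of the quotient field that properly contains `R`
is a valuative domain. -/
def IsMaximalNonValuativeDomain (R : Type*) [CommRing R] [IsDomain R] : Prop :=
  (⊥ : Subalgebra R (FractionRing R)) ≠ ⊤ ∧
    ¬ IsValuativeDomain R ∧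
    ∀ S : Subalgebra R (FractionRing R), ⊥ < S → IsValuativeDomain S

/-- The set of maximal ideals of `R`. -/
def maximalIdeals (R : Type*) [CommRing R] : Set (Ideal R) :=
  {M | M.IsMaximal}

/-- The set of prime ideals of `R` that are not maximal. -/
def nonMaximalPrimes (R : Type*) [CommRing R] : Set (Ideal R) :=
  {P | P.IsPrime ∧ ¬ P.IsMaximal}

/-! In a valuative domain, if a + b = 1 then a or b lies in at most one prime. Indeed R[a/b] =
R[1/b] and R[b/a] = R[1/a], and when R ⊆ R[1/b] has no intermediate ring only one prime can contain
b (`eq_of_hasNoIntermediateRing_adjoin_inv`).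

An integrally closed maximal non valuative domain R is not local, because an integrally closed local
domain with valuative proper overrings is a valuation ring, hence valuative. So each localization
R_M at a maximal ideal is a proper overring, therefore valuative, therefore a valuation ring. It
follows that the primes below each maximal ideal form a chain and that incomparable primes are
comaximal.

For comaximal I and J, inverting a suitable nonunit c gives a valuative overring. Hence one of I, J
lies in at most one prime among those missing a given proper ideal L (`eq_or_eq_of_isCoprime`). All
upper bounds and the uniqueness in (ii) come from choices of I, J, L. Conversely, as R itself is not
valuative, the denominator ideals of some x and 1/x are comaximal and each lies in two primes; this
gives existence in (ii). -/

open Polynomial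

/-! ### Denominators outside a prime and roots of polynomials -/

/-- The elements of an `R`-algebra that have a denominator outside the prime ideal `P`. -/
def denominatorSubalgebra {R : Type*} (A : Type*) [CommRing R] [CommRing A] [Algebra R A]
    (P : Ideal R) [hP : P.IsPrime] : Subalgebra R A where
  carrier := {y | ∃ s, s ∉ P ∧ ∃ r : R, s • y = algebraMap R A r}
  mul_mem' := by
    rintro x y ⟨s, hs, r, hr⟩ ⟨t, ht, q, hq⟩
    refine ⟨s * t, fun h => (hP.mem_or_mem h).elim hs ht, r * q, ?_⟩
    rw [map_mul, ← hr, ← hq, smul_mul_smul_comm]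
  add_mem' := by
    rintro x y ⟨s, hs, r, hr⟩ ⟨t, ht, q, hq⟩
    refine ⟨s * t, fun h => (hP.mem_or_mem h).elim hs ht, t * r + s * q, ?_⟩
    rw [map_add, map_mul, map_mul, ← hr, ← hq]
    simp only [Algebra.smul_def, map_mul]
    ring
  algebraMap_mem' r := ⟨1, hP.one_notMem, r, one_smul _ _⟩

theorem mem_denominatorSubalgebra {R A : Type*} [CommRing R] [CommRing A] [Algebra R A]
    {P : Ideal R} [P.IsPrime] {y : A} :
    y ∈ denominatorSubalgebra A P ↔ ∃ s, s ∉ P ∧ ∃ r : R, s • y = algebraMap R A r :=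
  Iff.rfl

/-- If `R` is integrally closed in `T` and `y ∈ T` is a root of a polynomial that is not zero
modulo the prime `P`, then `y` is a root of a linear polynomial that is not zero modulo `P`. -/
theorem exists_smul_eq_algebraMap_of_aeval_eq_zero {R A : Type*} [CommRing R] [CommRing A]
    [Algebra R A] {T : Subalgebra R A}
    (hT : ∀ z ∈ T, IsIntegral R z → z ∈ (⊥ : Subalgebra R A)) (P : Ideal R) [P.IsPrime]
    {y : A} (hy : y ∈ T) (f : R[X]) (hf : aeval y f = 0) (i : ℕ) (hi : f.coeff i ∉ P) :
    ∃ a d : R, a • y = algebraMap R A d ∧ (a ∉ P ∨ d ∉ P) := by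
  induction hn : f.natDegree using Nat.strong_induction_on generalizing f i with
  | _ n ih =>
  obtain _ | n := n
  · rw [eq_C_of_natDegree_eq_zero hn] at hf hi
    have hi0 : i = 0 := by
      by_contra h
      rw [coeff_C, if_neg h] at hi
      exact hi P.zero_mem
    subst hi0
    rw [coeff_C_zero] at hi
    rw [aeval_C] at hf
    exact ⟨f.coeff 0, 0, by rw [Algebra.smul_def, hf, zero_mul, map_zero], Or.inl hi⟩
  · obtain ⟨d, hd⟩ := Algebra.mem_bot.1
      (hT _ (T.smul_mem hy _) (isIntegral_leadingCoeff_smul f y hf))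
    by_cases h : f.leadingCoeff ∉ P ∨ d ∉ P
    · exact ⟨_, d, hd.symm, h⟩
    -- With n + 1 the degree of f, the leading term at y equals d y ^ n. Trading it for d X ^ n
    -- lowers the degree and changes coefficients only by elements of P, so coefficient i stays
    -- outside P.
    push Not at h
    have hle : (f.eraseLead + C d * X ^ n).natDegree ≤ n := by
      refine (natDegree_add_le _ _).trans (max_le ?_ (natDegree_C_mul_X_pow_le _ _))
      exact (eraseLead_natDegree_le f).trans (by omega)
    refine ih _ (by omega : (f.eraseLead + C d * X ^ n).natDegree < n + 1) _ ?_ i ?_ rfl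
    · have h2 := congrArg (aeval y) (eraseLead_add_C_mul_X_pow f)
      rw [hf, map_add, map_mul, map_pow, aeval_X, aeval_C, hn] at h2
      rw [map_add, map_mul, map_pow, aeval_X, aeval_C, hd, ← h2, Algebra.smul_def]
      ring
    · have hin : i ≠ f.natDegree := by
        rintro rfl
        exact hi h.1
      rw [coeff_add, eraseLead_coeff_of_ne i hin, coeff_C_mul_X_pow]
      intro h3
      apply hi
      have h4 : (if i = n then d else 0) ∈ P := by
        split_ifs
        exacts [h.2, P.zero_mem]
      exact (P.add_mem_iff_left h4).1 h3

/-! ### Primes of a valuative domain -/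

/-- If `b` is invertible in `A` with inverse `z` and there is no ring strictly between `R` and
`R[z]`, then at most one prime ideal of `R` contains `b`. -/
theorem eq_of_hasNoIntermediateRing_adjoin_inv {R A : Type*} [CommRing R] [CommRing A]
    [Algebra R A] [FaithfulSMul R A] {b : R} {z : A}
    (hbz : algebraMap R A b * z = 1)
    (h : HasNoIntermediateRing (Algebra.adjoin R {z})) {P Q : Ideal R} [hP : P.IsPrime]
    [hQ : Q.IsPrime] (hbP : b ∈ P) (hbQ : b ∈ Q) : Q ≤ P := by
  have hinj := FaithfulSMul.algebraMap_injective R A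
  have hzmem : z ∈ Algebra.adjoin R {z} := Algebra.self_mem_adjoin_singleton R z
  have hbz' : b • z = 1 := by rw [Algebra.smul_def, hbz]
  -- elements of `R[z]` that have a denominator outside a prime containing `b` lie in `R`
  have key : ∀ (I : Ideal R) [I.IsPrime], b ∈ I → ∀ y ∈ Algebra.adjoin R {z},
      ∀ s r : R, s ∉ I → s • y = algebraMap R A r → ∃ r : R, algebraMap R A r = y := by
    intro I _ hbI y hy s r hs hr
    rcases h (denominatorSubalgebra A I ⊓ Algebra.adjoin R {z}) inf_le_right with h1 | h1
    · have : y ∈ denominatorSubalgebra A I ⊓ Algebra.adjoin R {z} := ⟨⟨s, hs, r, hr⟩, hy⟩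
      rw [h1] at this
      exact Algebra.mem_bot.1 this
    · exfalso
      have : z ∈ denominatorSubalgebra A I ⊓ Algebra.adjoin R {z} := by rwa [h1]
      obtain ⟨⟨t, ht, q, hq⟩, -⟩ := this
      apply ht
      have : t = b * q := by
        apply hinj
        rw [map_mul, ← hq, Algebra.smul_def]
        linear_combination (-algebraMap R A t) * hbz
      rw [this]
      exact I.mul_mem_right _ hbI
  have hT : ∀ y ∈ Algebra.adjoin R {z}, IsIntegral R y → y ∈ (⊥ : Subalgebra R A) := by
    rcases h (integralClosure R A ⊓ Algebra.adjoin R {z}) inf_le_right with h1 | h1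
    · intro y hy hy'
      rw [← h1]
      exact ⟨hy', hy⟩
    · exfalso
      have hz : z ∈ integralClosure R A ⊓ Algebra.adjoin R {z} := by rwa [h1]
      have hz : IsIntegral R z := hz.1
      obtain ⟨f, hf, hfz⟩ := hz
      let : Invertible z := ⟨algebraMap R A b, hbz, by rw [mul_comm, hbz]⟩
      -- Reversing the monic equation of z gives one for b with constant term 1, so b divides 1.
      have h2 : f.reverse.eval b = 0 := by
        apply hinj
        rw [← eval₂_at_apply, map_zero]
        exact (eval₂_reverse_eq_zero_iff (algebraMap R A) z f).2 hfz
      have h3 := sub_dvd_eval_sub b 0 f.reverse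
      rw [h2, ← coeff_zero_eq_eval_zero, coeff_zero_reverse, hf.leadingCoeff, sub_zero,
        zero_sub, dvd_neg] at h3
      exact hP.one_notMem (P.mem_of_dvd h3 hbP)
  by_contra hQP
  obtain ⟨c, hcQ, hcP⟩ := SetLike.not_le_iff_exists.1 hQP
  set y := c • z with hy
  have hyT : y ∈ Algebra.adjoin R {z} := Subalgebra.smul_mem _ hzmem _
  have hby : b • y = algebraMap R A c := by
    rw [hy, smul_comm, hbz', Algebra.smul_def, mul_one]
  have hyR : ∀ r : R, algebraMap R A r ≠ y := by
    intro r hr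
    apply hcP
    have : c = b * r := hinj (by rw [← hby, ← hr, Algebra.smul_def, map_mul])
    exact this ▸ P.mul_mem_right _ hbP
  -- If R[y²] = R, then y is integral and so lies in R. Otherwise y ∈ R[y²], and y is a root of
  -- g(X²) - X, whose coefficient -1 at X avoids Q.
  have hfin : ∃ a d : R, a • y = algebraMap R A d ∧ (a ∉ Q ∨ d ∉ Q) := by
    have hle : Algebra.adjoin R {y ^ 2} ≤ Algebra.adjoin R {z} :=
      Algebra.adjoin_le (Set.singleton_subset_iff.2 (pow_mem hyT 2))
    rcases h _ hle with h1 | h1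
    · exfalso
      have h2 : y ^ 2 ∈ (⊥ : Subalgebra R A) := h1 ▸ Algebra.self_mem_adjoin_singleton R _
      obtain ⟨r, hr⟩ := Algebra.mem_bot.1 h2
      obtain ⟨r, hr⟩ := Algebra.mem_bot.1 (hT y hyT
        (IsIntegral.of_pow two_pos (hr ▸ isIntegral_algebraMap)))
      exact hyR r hr
    · rw [← h1] at hyT
      obtain ⟨g, hg⟩ := Algebra.adjoin_mem_exists_aeval R _ hyT
      rw [h1] at hyT
      refine exists_smul_eq_algebraMap_of_aeval_eq_zero hT Q hyT (expand R 2 g - X) ?_ 1 ?_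
      · rw [map_sub, expand_aeval, hg, aeval_X, sub_self]
      · rw [coeff_sub, coeff_expand two_pos, if_neg (by norm_num), coeff_X_one, zero_sub]
        rw [neg_mem_iff]
        exact hQ.one_notMem
  obtain ⟨a, d, had, h1⟩ := hfin
  have haQ : a ∈ Q := by
    by_contra haQ
    obtain ⟨r, hr⟩ := key Q hbQ y hyT a d haQ had
    exact hyR r hr
  have hdQ : d ∉ Q := by tauto
  -- Since c (a z) = a y = d with c outside P, the element a z lies in R. Then c divides d, which
  -- puts d in Q.
  obtain ⟨r, hr⟩ := key P hbP (a • z) (Subalgebra.smul_mem _ hzmem _) c d hcP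
    (by rw [← had, hy, smul_comm])
  apply hdQ
  have : d = c * r := hinj (by
    rw [← had, hy, map_mul, hr, smul_comm, Algebra.smul_def])
  exact this ▸ Q.mul_mem_right _ hcQ

/-- In a valuative domain, one of two elements with sum `1` lies in at most one prime ideal. -/
theorem IsValuativeDomain.eq_or_eq_of_add_eq_one {R : Type*} [CommRing R] [IsDomain R]
    (h : IsValuativeDomain R) {a b : R} (hab : a + b = 1) {P₁ P₂ Q₁ Q₂ : Ideal R}
    [hP₁ : P₁.IsPrime] [P₂.IsPrime] [hQ₁ : Q₁.IsPrime] [Q₂.IsPrime] (h₁ : a ∈ P₁) (h₂ : a ∈ P₂)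
    (h₃ : b ∈ Q₁) (h₄ : b ∈ Q₂) : P₁ = P₂ ∨ Q₁ = Q₂ := by
  have ha : algebraMap R (FractionRing R) a ≠ 0 := by
    rw [Ne, FaithfulSMul.algebraMap_eq_zero_iff]
    rintro rfl
    rw [zero_add] at hab
    exact hQ₁.one_notMem (hab ▸ h₃)
  have hb : algebraMap R (FractionRing R) b ≠ 0 := by
    rw [Ne, FaithfulSMul.algebraMap_eq_zero_iff]
    rintro rfl
    rw [add_zero] at hab
    exact hP₁.one_notMem (hab ▸ h₁)
  have hab' : algebraMap R (FractionRing R) a + algebraMap R (FractionRing R) b = 1 := by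
    rw [← map_add, hab, map_one]
  have hadj : ∀ x y : FractionRing R, y = x + 1 → Algebra.adjoin R {x} = Algebra.adjoin R {y} := by
    rintro x _ rfl
    apply le_antisymm <;> refine Algebra.adjoin_le (Set.singleton_subset_iff.2 ?_)
    · simpa using sub_mem (Algebra.self_mem_adjoin_singleton R (x + 1)) (one_mem _)
    · exact add_mem (Algebra.self_mem_adjoin_singleton R x) (one_mem _)
  rcases h (algebraMap R _ a / algebraMap R _ b) with h | h
  · right
    -- a/b + 1 = 1/b because a + b = 1.
    rw [hadj _ (algebraMap R (FractionRing R) b)⁻¹ (by field_simp; exact hab'.symm)] at h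
    have hbz := mul_inv_cancel₀ hb
    exact le_antisymm (eq_of_hasNoIntermediateRing_adjoin_inv hbz h h₄ h₃)
      (eq_of_hasNoIntermediateRing_adjoin_inv hbz h h₃ h₄)
  · left
    rw [hadj _ (algebraMap R (FractionRing R) a)⁻¹
      (by field_simp; rw [add_comm]; exact hab'.symm)] at h
    have hbz := mul_inv_cancel₀ ha
    exact le_antisymm (eq_of_hasNoIntermediateRing_adjoin_inv hbz h h₂ h₁)
      (eq_of_hasNoIntermediateRing_adjoin_inv hbz h h₁ h₂)

/-! ### Integrally closed local domains and valuation rings -/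

/-- Over an integrally closed local domain, an element `x` of the quotient field that is a root
of a polynomial with a unit coefficient satisfies `x ∈ R` or `x⁻¹ ∈ R`. -/
theorem mem_bot_or_inv_mem_bot_of_aeval_eq_zero {R : Type*} (K : Type*) [CommRing R] [IsDomain R]
    [IsIntegrallyClosed R] [IsLocalRing R] [Field K] [Algebra R K] [IsFractionRing R K] (x : K)
    (f : R[X]) (hf : aeval x f = 0) (i : ℕ) (hi : IsUnit (f.coeff i)) :
    x ∈ (⊥ : Subalgebra R K) ∨ x⁻¹ ∈ (⊥ : Subalgebra R K) := by
  have hT : ∀ z ∈ (⊤ : Subalgebra R K), IsIntegral R z → z ∈ (⊥ : Subalgebra R K) :=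
    fun z _ hz => Algebra.mem_bot.2 (IsIntegrallyClosed.isIntegral_iff.1 hz)
  obtain ⟨a, d, had, h⟩ := exists_smul_eq_algebraMap_of_aeval_eq_zero hT
    (IsLocalRing.maximalIdeal R) (Algebra.mem_top (x := x)) f hf i (by simpa using hi)
  simp only [IsLocalRing.mem_maximalIdeal, mem_nonunits_iff, not_not] at h
  rw [Algebra.smul_def] at had
  simp only [Algebra.mem_bot, Set.mem_range]
  rcases h with h | h
  · left
    obtain ⟨u, rfl⟩ := h
    refine ⟨↑u⁻¹ * d, ?_⟩
    rw [map_mul, ← had, ← mul_assoc, ← map_mul, Units.inv_mul, map_one, one_mul]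
  · right
    obtain ⟨u, rfl⟩ := h
    refine ⟨↑u⁻¹ * a, eq_inv_of_mul_eq_one_left ?_⟩
    rw [map_mul, mul_assoc, had, ← map_mul, Units.inv_mul, map_one]

/-- Squares suffice: if R ⊆ R[y] has no intermediate ring, then either y² ∈ R and y is integral, or
y ∈ R[y²] and y is a root of a polynomial with coefficient -1 at X. -/
theorem IsValuativeDomain.valuationRing {R : Type*} [CommRing R] [IsDomain R]
    [IsIntegrallyClosed R] [IsLocalRing R] (h : IsValuativeDomain R) : ValuationRing R := by
  have key : ∀ y : FractionRing R, HasNoIntermediateRing (Algebra.adjoin R {y}) →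
      y ∈ (⊥ : Subalgebra R (FractionRing R)) ∨ y⁻¹ ∈ (⊥ : Subalgebra R (FractionRing R)) := by
    intro y hy
    have hyT := Algebra.self_mem_adjoin_singleton R y
    rcases hy _ (Algebra.adjoin_le (Set.singleton_subset_iff.2 (pow_mem hyT 2))) with h1 | h1
    · left
      have h2 : y ^ 2 ∈ (⊥ : Subalgebra R (FractionRing R)) :=
        h1 ▸ Algebra.self_mem_adjoin_singleton R _
      obtain ⟨r, hr⟩ := Algebra.mem_bot.1 h2
      exact Algebra.mem_bot.2 (IsIntegrallyClosed.isIntegral_iff.1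
        (IsIntegral.of_pow two_pos (hr ▸ isIntegral_algebraMap)))
    · rw [← h1] at hyT
      obtain ⟨g, hg⟩ := Algebra.adjoin_mem_exists_aeval R _ hyT
      refine mem_bot_or_inv_mem_bot_of_aeval_eq_zero _ y (expand R 2 g - X) ?_ 1 ?_
      · rw [map_sub, expand_aeval, hg, aeval_X, sub_self]
      · rw [coeff_sub, coeff_expand two_pos, if_neg (by norm_num), coeff_X_one, zero_sub]
        exact isUnit_one.neg
  rw [ValuationRing.iff_isInteger_or_isInteger R (FractionRing R)]
  intro x
  rcases h x with h | h
  · simpa [Algebra.mem_bot, IsLocalization.IsInteger] using key x h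
  · simpa [Algebra.mem_bot, IsLocalization.IsInteger, or_comm] using key x⁻¹ h

theorem isValuativeDomain_of_valuationRing (R : Type*) [CommRing R] [IsDomain R]
    [ValuationRing R] : IsValuativeDomain R := by
  have key : ∀ y : FractionRing R, IsLocalization.IsInteger R y →
      HasNoIntermediateRing (Algebra.adjoin R {y}) := by
    rintro y ⟨r, hr⟩ S hS
    left
    refine eq_bot_iff.2 (hS.trans (Algebra.adjoin_le (Set.singleton_subset_iff.2 ?_)))
    exact Algebra.mem_bot.2 ⟨r, hr⟩
  exact fun x => (ValuationRing.isInteger_or_isInteger R x).imp (key x) (key x⁻¹)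

/-- If neither `x` nor `x⁻¹` lies in the integrally closed local domain `R`, then the value at
`x` of a nonconstant monic polynomial is not a unit of `R[x]`. -/
theorem not_isUnit_aeval_adjoin_of_monic {R K : Type*} [CommRing R] [IsDomain R]
    [IsIntegrallyClosed R] [IsLocalRing R] [Field K] [Algebra R K] [IsFractionRing R K] {x : K}
    (hx : x ∉ (⊥ : Subalgebra R K)) (hx' : x⁻¹ ∉ (⊥ : Subalgebra R K)) {p : R[X]}
    (hp : p.Monic) (hdeg : p.natDegree ≠ 0) :
    ¬ IsUnit (aeval (⟨x, Algebra.self_mem_adjoin_singleton R x⟩ : Algebra.adjoin R {x}) p) := by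
  intro hu
  obtain ⟨⟨t, ht⟩, hpt⟩ := hu.exists_right_inv
  obtain ⟨q, rfl⟩ := Algebra.adjoin_mem_exists_aeval R _ ht
  have hpt : aeval x p * aeval x q = 1 := by
    have := congrArg (Algebra.adjoin R {x}).val hpt
    rwa [map_mul, map_one, ← aeval_algHom_apply] at this
  -- A unit coefficient of pq - 1 would force x or its inverse into R. So pq = 1 over the residue
  -- field, where p would have to be constant.
  have hzero : map (IsLocalRing.residue R) (p * q - 1) = 0 := by
    ext i
    rw [coeff_map, coeff_zero, IsLocalRing.residue_eq_zero_iff, IsLocalRing.mem_maximalIdeal]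
    intro hi
    rcases mem_bot_or_inv_mem_bot_of_aeval_eq_zero K x (p * q - 1)
      (by rw [map_sub, map_mul, map_one, hpt, sub_self]) i hi with h | h
    exacts [hx h, hx' h]
  rw [Polynomial.map_sub, Polynomial.map_mul, Polynomial.map_one, sub_eq_zero] at hzero
  have := natDegree_eq_zero_of_isUnit (IsUnit.of_mul_eq_one _ hzero)
  rw [hp.natDegree_map] at this
  exact hdeg this

/-- An integrally closed local domain all of whose proper overrings are valuative is a
valuation ring. -/
theorem valuationRing_of_isValuativeDomain_overrings {R : Type*} [CommRing R] [IsDomain R]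
    [IsIntegrallyClosed R] [IsLocalRing R]
    (h : ∀ S : Subalgebra R (FractionRing R), ⊥ < S → IsValuativeDomain S) :
    ValuationRing R := by
  rw [ValuationRing.iff_isInteger_or_isInteger R (FractionRing R)]
  by_contra! hx
  obtain ⟨x, hx, hx'⟩ := hx
  replace hx : x ∉ (⊥ : Subalgebra R (FractionRing R)) := fun h => hx (Algebra.mem_bot.1 h)
  replace hx' : x⁻¹ ∉ (⊥ : Subalgebra R (FractionRing R)) := fun h => hx' (Algebra.mem_bot.1 h)
  have hxT := Algebra.self_mem_adjoin_singleton R x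
  have hval := h (Algebra.adjoin R {x}) (bot_lt_iff_ne_bot.2 fun h => hx (h ▸ hxT))
  have hnu := fun (p : R[X]) => not_isUnit_aeval_adjoin_of_monic hx hx' (p := p)
  set t : Algebra.adjoin R {x} := ⟨x, hxT⟩ with ht
  have hmax : ∀ z : Algebra.adjoin R {x}, ¬ IsUnit z →
      ∃ M : Ideal (Algebra.adjoin R {x}), M.IsMaximal ∧ z ∈ M := fun z hz =>
    exists_max_ideal_of_mem_nonunits hz
  have hd1 : (X * (X - 1) - 1 : R[X]).natDegree = 2 := by compute_degree!
  have hm1 : (X * (X - 1) - 1 : R[X]).Monic := by monicity!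
  have hd2 : ((X * (X - 1)) ^ 2 - X * (X - 1) - 1 : R[X]).natDegree = 4 := by compute_degree!
  have hm2 : ((X * (X - 1)) ^ 2 - X * (X - 1) - 1 : R[X]).Monic := by monicity!
  obtain ⟨P₁, hP₁, h₁⟩ := hmax t (by simpa using hnu X monic_X (by simp))
  obtain ⟨P₂, hP₂, h₂⟩ := hmax (t - 1) (by
    simpa using hnu (X - C 1) (monic_X_sub_C 1) (by rw [natDegree_X_sub_C]; exact one_ne_zero))
  obtain ⟨Q₁, hQ₁, h₃⟩ := hmax (t * (t - 1) - 1) (by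
    simpa using hnu _ hm1 (by rw [hd1]; norm_num))
  obtain ⟨Q₂, hQ₂, h₄⟩ := hmax ((t * (t - 1)) ^ 2 - t * (t - 1) - 1) (by
    simpa using hnu _ hm2 (by rw [hd2]; norm_num))
  have := hP₁.isPrime
  have := hP₂.isPrime
  have := hQ₁.isPrime
  have := hQ₂.isPrime
  -- With u = t(t - 1), a = u²(2 - u) and b = (u - 1)(u² - u - 1) = u³ - 2u² + 1 add up to 1. The
  -- factors t, t - 1 of a are nonunits and comaximal, and so are u - 1, u² - u - 1, as u(u - 1) -
  -- (u² - u - 1) = 1. Thus a and b each lie in two distinct primes.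
  rcases hval.eq_or_eq_of_add_eq_one
    (a := t * ((t - 1) * (t * (t - 1) * (2 - t * (t - 1)))))
    (b := (t * (t - 1) - 1) * ((t * (t - 1)) ^ 2 - t * (t - 1) - 1)) (by ring)
    (P₁ := P₁) (P₂ := P₂) (Q₁ := Q₁) (Q₂ := Q₂)
    (P₁.mul_mem_right _ h₁) (P₂.mul_mem_left _ (P₂.mul_mem_right _ h₂))
    (Q₁.mul_mem_right _ h₃) (Q₂.mul_mem_left _ h₄) with rfl | rfl
  · apply hP₁.isPrime.one_notMem
    simpa using P₁.sub_mem h₁ h₂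
  · apply hQ₁.isPrime.one_notMem
    have := Q₁.sub_mem (Q₁.mul_mem_left (t * (t - 1)) h₃) h₄
    ring_nf at this
    exact this

/-! ### Denominator ideals and locally valuation domains -/

/-- The ideal of the `s : R` such that `s • x` lies in (the image of) `R`. -/
def denominatorIdeal (R : Type*) {A : Type*} [CommRing R] [CommRing A] [Algebra R A] (x : A) :
    Ideal R :=
  (LinearMap.range (Algebra.linearMap R A)).comap (LinearMap.toSpanSingleton R A x)

theorem mem_denominatorIdeal {R A : Type*} [CommRing R] [CommRing A] [Algebra R A] {x : A}
    {s : R} : s ∈ denominatorIdeal R x ↔ ∃ r : R, algebraMap R A r = s • x :=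
  Iff.rfl

theorem denominatorIdeal_eq_top_iff {R A : Type*} [CommRing R] [CommRing A] [Algebra R A]
    {x : A} : denominatorIdeal R x = ⊤ ↔ x ∈ (⊥ : Subalgebra R A) := by
  rw [Ideal.eq_top_iff_one, mem_denominatorIdeal, one_smul, Algebra.mem_bot, Set.mem_range]

theorem mem_denominatorSubalgebra_iff_not_le {R A : Type*} [CommRing R] [CommRing A] [Algebra R A]
    {P : Ideal R} [P.IsPrime] {x : A} :
    x ∈ denominatorSubalgebra A P ↔ ¬ denominatorIdeal R x ≤ P := by
  rw [SetLike.not_le_iff_exists, mem_denominatorSubalgebra]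
  simp only [mem_denominatorIdeal, eq_comm, and_comm]

/-- The localizations of `R` at its maximal ideals are valuation rings: every element of the
quotient field, or its inverse, has a denominator outside the given maximal ideal. -/
def IsLocallyValuation (R : Type*) [CommRing R] [IsDomain R] : Prop :=
  ∀ (M : Ideal R), M.IsMaximal → ∀ y : FractionRing R,
    ∃ a d : R, a • y = algebraMap R (FractionRing R) d ∧ (a ∉ M ∨ d ∉ M)

/-- If at most one prime contains the denominator ideal of `x`, there is no ring strictly
between `R` and `R[x]`. -/
theorem IsLocallyValuation.hasNoIntermediateRing_adjoin {R : Type*} [CommRing R] [IsDomain R]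
    (hR : IsLocallyValuation R) (x : FractionRing R)
    (hx : ∀ P Q : Ideal R, P.IsPrime → Q.IsPrime → denominatorIdeal R x ≤ P →
      denominatorIdeal R x ≤ Q → P = Q) :
    HasNoIntermediateRing (Algebra.adjoin R {x}) := by
  intro S hS
  by_cases hxS : x ∈ S
  · right
    exact le_antisymm hS (Algebra.adjoin_le (Set.singleton_subset_iff.2 hxS))
  left
  have htop : denominatorIdeal S x ≠ ⊤ := by
    intro h
    obtain ⟨r, hr⟩ := Algebra.mem_bot.1 (denominatorIdeal_eq_top_iff.1 h)
    exact hxS (hr ▸ r.2)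
  obtain ⟨N', hN', hle⟩ := Ideal.exists_le_maximal _ htop
  have hle' : denominatorIdeal R x ≤ N'.comap (algebraMap R S) := by
    rintro s ⟨r, hr⟩
    exact hle ⟨algebraMap R S r, by simpa [Algebra.smul_def] using hr⟩
  have hprime : (N'.comap (algebraMap R S)).IsPrime := Ideal.IsPrime.comap (hK := hN'.isPrime) _
  refine eq_bot_iff.2 fun y hy => ?_
  rw [← denominatorIdeal_eq_top_iff]
  by_contra htop'
  obtain ⟨N, hN, hyN⟩ := Ideal.exists_le_maximal _ htop'
  have hNp := hN.isPrime
  -- If N contains the denominators of x, then N is the contraction of N', and the valuation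
  -- property at N writes a y = d with a in N and d outside, impossible as y ∈ S. Otherwise x, hence
  -- R[x] and y, have denominators outside N.
  by_cases hxN : denominatorIdeal R x ≤ N
  · have hNN' := hx _ _ hNp hprime hxN hle'
    obtain ⟨a, d, had, h⟩ := hR N hN y
    have haN : a ∈ N := hyN ⟨d, had.symm⟩
    have hdN : d ∉ N := by tauto
    apply hdN
    rw [hNN', Ideal.mem_comap] at haN ⊢
    have : algebraMap R S d = algebraMap R S a * ⟨y, hy⟩ := by
      apply Subtype.ext
      simpa [Algebra.smul_def] using had.symm
    rw [this]
    exact N'.mul_mem_right _ haN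
  · have hxd : x ∈ denominatorSubalgebra (FractionRing R) N :=
      mem_denominatorSubalgebra_iff_not_le.2 hxN
    have := Algebra.adjoin_le (Set.singleton_subset_iff.2 hxd) (hS hy)
    exact mem_denominatorSubalgebra_iff_not_le.1 this hyN

/-- At every maximal ideal M, x or its inverse lies in the valuation ring R_M, so M misses one of
the two ideals. -/
theorem IsLocallyValuation.isCoprime_denominatorIdeal {R : Type*} [CommRing R] [IsDomain R]
    (hR : IsLocallyValuation R) (x : FractionRing R) :
    IsCoprime (denominatorIdeal R x) (denominatorIdeal R x⁻¹) := by
  rw [Ideal.isCoprime_iff_sup_eq]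
  by_contra htop
  obtain ⟨M, hM, hle⟩ := Ideal.exists_le_maximal _ htop
  obtain ⟨a, d, had, h⟩ := hR M hM x
  rcases h with h | h
  · exact h (hle (Ideal.mem_sup_left ⟨d, had.symm⟩))
  · apply h (hle (Ideal.mem_sup_right (mem_denominatorIdeal.2 ⟨a, ?_⟩)))
    rw [Algebra.smul_def] at had ⊢
    have hx : x ≠ 0 := by
      rintro rfl
      rw [mul_zero, eq_comm, FaithfulSMul.algebraMap_eq_zero_iff] at had
      exact h (had ▸ M.zero_mem)
    rw [← had, mul_inv_cancel_right₀ hx]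

/-- In a locally valuation domain that is not valuative there are two comaximal ideals each of
which is contained in two distinct primes. -/
theorem IsLocallyValuation.exists_isCoprime_of_not_isValuativeDomain {R : Type*} [CommRing R]
    [IsDomain R] (hR : IsLocallyValuation R) (h : ¬ IsValuativeDomain R) :
    ∃ I J P₁ P₂ Q₁ Q₂ : Ideal R, IsCoprime I J ∧
      (P₁.IsPrime ∧ P₂.IsPrime ∧ I ≤ P₁ ∧ I ≤ P₂ ∧ P₁ ≠ P₂) ∧
      (Q₁.IsPrime ∧ Q₂.IsPrime ∧ J ≤ Q₁ ∧ J ≤ Q₂ ∧ Q₁ ≠ Q₂) := by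
  unfold IsValuativeDomain at h
  push Not at h
  obtain ⟨x, hx, hx'⟩ := h
  have h1 := mt (hR.hasNoIntermediateRing_adjoin x) hx
  have h2 := mt (hR.hasNoIntermediateRing_adjoin x⁻¹) hx'
  push Not at h1 h2
  obtain ⟨P₁, P₂, hP⟩ := h1
  obtain ⟨Q₁, Q₂, hQ⟩ := h2
  exact ⟨_, _, P₁, P₂, Q₁, Q₂, hR.isCoprime_denominatorIdeal x, hP, hQ⟩

/-- In a locally valuation domain, the primes inside a given maximal ideal form a chain. -/
theorem IsLocallyValuation.le_total_of_le {R : Type*} [CommRing R] [IsDomain R]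
    (hR : IsLocallyValuation R) {M P Q : Ideal R} (hM : M.IsMaximal) (hP : P.IsPrime)
    (hQ : Q.IsPrime) (hPM : P ≤ M) (hQM : Q ≤ M) : P ≤ Q ∨ Q ≤ P := by
  by_contra! h
  obtain ⟨p, hpP, hpQ⟩ := SetLike.not_le_iff_exists.1 h.1
  obtain ⟨q, hqQ, hqP⟩ := SetLike.not_le_iff_exists.1 h.2
  have hq : algebraMap R (FractionRing R) q ≠ 0 := by
    rw [Ne, FaithfulSMul.algebraMap_eq_zero_iff]
    rintro rfl
    exact hqP P.zero_mem
  obtain ⟨a, d, had, h⟩ := hR M hM (algebraMap R _ p / algebraMap R _ q)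
  have had : a * p = d * q := by
    apply FaithfulSMul.algebraMap_injective R (FractionRing R)
    rw [Algebra.smul_def, ← mul_div_assoc, div_eq_iff hq] at had
    rw [map_mul, map_mul, had]
  rcases h with h | h
  · exact (hQ.mem_or_mem (had ▸ Q.mul_mem_left d hqQ : a * p ∈ Q)).elim (fun h' => h (hQM h')) hpQ
  · exact (hP.mem_or_mem (had ▸ P.mul_mem_left a hpP : d * q ∈ P)).elim (fun h' => h (hPM h')) hqP

/-! ### Localizations of a maximal non valuative domain -/

theorem bot_lt_localizationSubalgebra {R : Type*} [CommRing R] [IsDomain R] (S : Submonoid R)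
    (hS : S ≤ nonZeroDivisors R) {c : R} (hc : c ∈ S) (hcu : ¬ IsUnit c) :
    ⊥ < Localization.subalgebra.ofField (FractionRing R) S hS := by
  refine bot_lt_iff_ne_bot.2 fun h => hcu ?_
  have hmem : (algebraMap R (FractionRing R) c)⁻¹ ∈
      Localization.subalgebra.ofField (FractionRing R) S hS := ⟨1, c, hc, by simp⟩
  rw [h] at hmem
  obtain ⟨r, hr⟩ := Algebra.mem_bot.1 hmem
  have hc0 : algebraMap R (FractionRing R) c ≠ 0 := by
    rw [Ne, FaithfulSMul.algebraMap_eq_zero_iff]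
    exact nonZeroDivisors.ne_zero (hS hc)
  refine IsUnit.of_mul_eq_one r (FaithfulSMul.algebraMap_injective R (FractionRing R) ?_)
  rw [map_mul, hr, map_one, mul_inv_cancel₀ hc0]

theorem IsMaximalNonValuativeDomain.not_isLocalRing {R : Type*} [CommRing R] [IsDomain R]
    [IsIntegrallyClosed R] (hR : IsMaximalNonValuativeDomain R) : ¬ IsLocalRing R := by
  intro _
  have := valuationRing_of_isValuativeDomain_overrings hR.2.2
  exact hR.2.1 (isValuativeDomain_of_valuationRing R)

theorem IsMaximalNonValuativeDomain.isLocallyValuation {R : Type*} [CommRing R] [IsDomain R]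
    [IsIntegrallyClosed R] (hR : IsMaximalNonValuativeDomain R) : IsLocallyValuation R := by
  intro M hM y
  have hMp := hM.isPrime
  have hS := M.primeCompl_le_nonZeroDivisors
  obtain ⟨c, hcM, hcu⟩ : ∃ c, c ∉ M ∧ ¬ IsUnit c := by
    by_contra! h
    exact hR.not_isLocalRing (IsLocalRing.of_unique_max_ideal ⟨M, hM, fun N hN => by
      refine hN.eq_of_le hM.ne_top fun z hz => ?_
      by_contra hzM
      exact hN.ne_top (Ideal.eq_top_of_isUnit_mem _ hz (h z hzM))⟩)
  have hval := hR.2.2 _ (bot_lt_localizationSubalgebra M.primeCompl hS hcM hcu)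
  set V := Localization.subalgebra.ofField (FractionRing R) M.primeCompl hS with hV
  have : IsLocalization.AtPrime V M := Localization.subalgebra.isLocalization_ofField _ _ _
  have : IsLocalRing V := IsLocalization.AtPrime.isLocalRing V M
  have : IsIntegrallyClosed V := isIntegrallyClosed_of_isLocalization _ M.primeCompl hS
  have := hval.valuationRing
  rcases ValuationRing.isInteger_or_isInteger V y with
    ⟨⟨_, a, s, hs, rfl⟩, hr⟩ | ⟨⟨_, a, s, hs, rfl⟩, hr⟩
  · have hs0 : algebraMap R (FractionRing R) s ≠ 0 := by
      rw [Ne, FaithfulSMul.algebraMap_eq_zero_iff]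
      exact nonZeroDivisors.ne_zero (hS hs)
    refine ⟨s, a, ?_, Or.inl hs⟩
    have hr : algebraMap R (FractionRing R) a * (algebraMap R (FractionRing R) s)⁻¹ = y := hr
    rw [← hr, Algebra.smul_def]
    field_simp
  · have hs0 : algebraMap R (FractionRing R) s ≠ 0 := by
      rw [Ne, FaithfulSMul.algebraMap_eq_zero_iff]
      exact nonZeroDivisors.ne_zero (hS hs)
    have hr : algebraMap R (FractionRing R) a * (algebraMap R (FractionRing R) s)⁻¹ = y⁻¹ := hr
    by_cases hy : y = 0
    · exact ⟨1, 0, by simp [hy], Or.inl hMp.one_notMem⟩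
    refine ⟨a, s, ?_, Or.inr hs⟩
    rw [Algebra.smul_def]
    field_simp at hr
    exact hr

theorem Ideal.exists_mem_forall_notMem_of_forall_not_le {R : Type*} [CommRing R] {I : Ideal R}
    (s : Finset (Ideal R)) (hs : ∀ P ∈ s, P.IsPrime) (h : ∀ P ∈ s, ¬ I ≤ P) :
    ∃ c ∈ I, ∀ P ∈ s, c ∉ P := by
  -- Prime avoidance permits two non-prime exceptions; none is needed, so `⊥` fills both slots.
  have := mt (Ideal.subset_union_prime (s := s) (f := id) ⊥ ⊥ fun P hP _ _ => hs P hP).1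
    (fun ⟨P, hP, hle⟩ => h P hP hle)
  rw [Set.not_subset] at this
  obtain ⟨c, hc, hc'⟩ := this
  exact ⟨c, hc, fun P hP hcP => hc' (Set.mem_biUnion (Finset.mem_coe.2 hP) hcP)⟩

/-- In a maximal non valuative domain, given a proper ideal `L` and comaximal `I` and `J`, one of
`I` and `J` is contained in at most one prime not containing `L`. -/
theorem IsMaximalNonValuativeDomain.eq_or_eq_of_isCoprime {R : Type*} [CommRing R] [IsDomain R]
    (hR : IsMaximalNonValuativeDomain R) {I J L P₁ P₂ Q₁ Q₂ : Ideal R} (hL : L ≠ ⊤)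
    (hIJ : IsCoprime I J) (hP₁ : P₁.IsPrime) (hP₂ : P₂.IsPrime) (hQ₁ : Q₁.IsPrime)
    (hQ₂ : Q₂.IsPrime) (h₁ : I ≤ P₁) (h₂ : I ≤ P₂) (h₃ : J ≤ Q₁) (h₄ : J ≤ Q₂)
    (hL₁ : ¬ L ≤ P₁) (hL₂ : ¬ L ≤ P₂) (hL₃ : ¬ L ≤ Q₁) (hL₄ : ¬ L ≤ Q₂) :
    P₁ = P₂ ∨ Q₁ = Q₂ := by
  classical
  -- Membership of c in L makes it a nonunit, so R[1/c] is a proper overring; the four primes avoid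
  -- c and stay distinct primes there if distinct in R.
  obtain ⟨c, hcL, hc⟩ := Ideal.exists_mem_forall_notMem_of_forall_not_le (I := L)
    {P₁, P₂, Q₁, Q₂} (by simp [hP₁, hP₂, hQ₁, hQ₂]) (by simp [hL₁, hL₂, hL₃, hL₄])
  simp only [Finset.mem_insert, Finset.mem_singleton, forall_eq_or_imp, forall_eq] at hc
  obtain ⟨hc₁, hc₂, hc₃, hc₄⟩ := hc
  have hc0 : c ≠ 0 := by
    rintro rfl
    exact hc₁ P₁.zero_mem
  have hcu : ¬ IsUnit c := fun h => hL (Ideal.eq_top_of_isUnit_mem _ hcL h)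
  have hS := powers_le_nonZeroDivisors_of_noZeroDivisors hc0
  have hval := hR.2.2 _ (bot_lt_localizationSubalgebra (Submonoid.powers c) hS
    (Submonoid.mem_powers c) hcu)
  set V := Localization.subalgebra.ofField (FractionRing R) (Submonoid.powers c) hS with hV
  have : IsLocalization (Submonoid.powers c) V :=
    Localization.subalgebra.isLocalization_ofField _ _ _
  have hdisj : ∀ P : Ideal R, P.IsPrime → c ∉ P →
      Disjoint (Submonoid.powers c : Set R) (P : Set R) := fun P hP hcP =>
    (Ideal.disjoint_powers_iff_notMem_of_isPrime _).2 hcP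
  have hpr : ∀ P : Ideal R, P.IsPrime → c ∉ P → (P.map (algebraMap R V)).IsPrime :=
    fun P hP hcP => IsLocalization.isPrime_of_isPrime_disjoint _ V P hP (hdisj P hP hcP)
  have hinj : ∀ P Q : Ideal R, P.IsPrime → c ∉ P → Q.IsPrime → c ∉ Q →
      P.map (algebraMap R V) = Q.map (algebraMap R V) → P = Q := by
    intro P Q hP hcP hQ hcQ h
    rw [← IsLocalization.under_map_of_isPrime_disjoint _ V hP (hdisj P hP hcP), h,
      IsLocalization.under_map_of_isPrime_disjoint _ V hQ (hdisj Q hQ hcQ)]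
  obtain ⟨a, ha, b, hb, hab⟩ := Ideal.isCoprime_iff_exists.1 hIJ
  have := hpr P₁ hP₁ hc₁
  have := hpr P₂ hP₂ hc₂
  have := hpr Q₁ hQ₁ hc₃
  have := hpr Q₂ hQ₂ hc₄
  exact (hval.eq_or_eq_of_add_eq_one (a := algebraMap R V a) (b := algebraMap R V b)
    (by rw [← map_add, hab, map_one]) (Ideal.mem_map_of_mem _ (h₁ ha))
    (Ideal.mem_map_of_mem _ (h₂ ha)) (Ideal.mem_map_of_mem _ (h₃ hb))
    (Ideal.mem_map_of_mem _ (h₄ hb))).imp (hinj _ _ hP₁ hc₁ hP₂ hc₂) (hinj _ _ hQ₁ hc₃ hQ₂ hc₄)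

/-! ### Counting maximal ideals and comparing primes -/

theorem Set.exists_injective_fin_of_le_encard {α : Type*} {s : Set α} {n : ℕ}
    (h : (n : ℕ∞) ≤ s.encard) : ∃ f : Fin n → α, Function.Injective f ∧ ∀ i, f i ∈ s := by
  obtain ⟨t, hts, ht⟩ := Set.exists_subset_encard_eq h
  have hfin := Set.finite_of_encard_eq_coe ht
  have hcard : hfin.toFinset.card = n := by
    rw [hfin.encard_eq_coe_toFinset_card] at ht
    exact_mod_cast ht
  let e := (Finset.equivFinOfCardEq hcard).symm
  exact ⟨fun i => (e i : α), Subtype.val_injective.comp e.injective,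
    fun i => hts (hfin.mem_toFinset.1 (e i).2)⟩

theorem Ideal.IsMaximal.not_le_of_ne {R : Type*} [CommRing R] {M N : Ideal R} (hM : M.IsMaximal)
    (hN : N.IsMaximal) (h : M ≠ N) : ¬ M ≤ N :=
  fun hle => h (hM.eq_of_le hN.ne_top hle)

/-- Two ideals such that no maximal ideal contains both are comaximal. -/
theorem Ideal.isCoprime_of_forall_isMaximal {R : Type*} [CommRing R] {I J : Ideal R}
    (h : ∀ M : Ideal R, M.IsMaximal → I ≤ M → ¬ J ≤ M) : IsCoprime I J := by
  rw [Ideal.isCoprime_iff_sup_eq]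
  by_contra hne
  obtain ⟨M, hM, hle⟩ := Ideal.exists_le_maximal _ hne
  exact h M hM (le_sup_left.trans hle) (le_sup_right.trans hle)

namespace IsMaximalNonValuativeDomain

variable {R : Type*} [CommRing R] [IsDomain R]

/-- Of five maximal ideals, one serves as L and the others pair up into two comaximal products. -/
theorem encard_maximalIdeals_le_four (hR : IsMaximalNonValuativeDomain R) :
    (maximalIdeals R).encard ≤ 4 := by
  by_contra! h
  obtain ⟨f, hf, hmax⟩ := Set.exists_injective_fin_of_le_encard (n := 5)
    (Order.add_one_le_of_lt h)
  have hcop : ∀ i j, i ≠ j → IsCoprime (f i) (f j) := fun i j hij =>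
    @Ideal.isCoprime_of_isMaximal _ _ _ _ (hmax i) (hmax j) (hf.ne hij)
  have hnle : ∀ i j, i ≠ j → ¬ f i ≤ f j := fun i j hij =>
    Ideal.IsMaximal.not_le_of_ne (hmax i) (hmax j) (hf.ne hij)
  have hp : ∀ i, (f i).IsPrime := fun i => Ideal.IsMaximal.isPrime (hmax i)
  rcases hR.eq_or_eq_of_isCoprime (L := f 0) (I := f 1 * f 2) (J := f 3 * f 4) (hp 0).ne_top
    (((hcop 1 3 (by decide)).mul_right (hcop 1 4 (by decide))).mul_left
      ((hcop 2 3 (by decide)).mul_right (hcop 2 4 (by decide))))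
    (hp 1) (hp 2) (hp 3) (hp 4) Ideal.mul_le_left Ideal.mul_le_right Ideal.mul_le_left
    Ideal.mul_le_right (hnle _ _ (by decide)) (hnle _ _ (by decide)) (hnle _ _ (by decide))
    (hnle _ _ (by decide)) with h | h
  · exact absurd (hf h) (by decide)
  · exact absurd (hf h) (by decide)

variable [IsIntegrallyClosed R]

theorem isCoprime_of_not_le (hR : IsMaximalNonValuativeDomain R) {P Q : Ideal R}
    (hP : P.IsPrime) (hQ : Q.IsPrime) (hPQ : ¬ P ≤ Q) (hQP : ¬ Q ≤ P) : IsCoprime P Q :=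
  Ideal.isCoprime_of_forall_isMaximal fun _ hM hPM hQM =>
    (hR.isLocallyValuation.le_total_of_le hM hP hQ hPM hQM).elim hPQ hQP

theorem two_le_encard_maximalIdeals (hR : IsMaximalNonValuativeDomain R) :
    2 ≤ (maximalIdeals R).encard := by
  have h : 1 < (maximalIdeals R).encard := by
    rw [Set.one_lt_encard_iff]
    obtain ⟨M, hM⟩ := Ideal.exists_maximal R
    by_contra! h
    exact hR.not_isLocalRing
      (IsLocalRing.of_unique_max_ideal ⟨M, hM, fun N hN => h N M hN hM⟩)
  exact Order.add_one_le_of_lt h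

/-- Incomparable non-maximal P and Q would be comaximal, each lying in itself and in a maximal ideal
above it; a third maximal ideal serves as L. -/
theorem isChain_nonMaximalPrimes (hR : IsMaximalNonValuativeDomain R)
    (hcard : (maximalIdeals R).encard ≠ 2) : IsChain (· ≤ ·) (nonMaximalPrimes R) := by
  intro P hP Q hQ _
  by_contra! h
  have hcop := hR.isCoprime_of_not_le hP.1 hQ.1 h.1 h.2
  obtain ⟨M, hM, hPM⟩ := Ideal.exists_le_maximal P hP.1.ne_top
  obtain ⟨N, hN, hQN⟩ := Ideal.exists_le_maximal Q hQ.1.ne_top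
  obtain ⟨L, hL, hLM, hLN⟩ : ∃ L : Ideal R, L.IsMaximal ∧ L ≠ M ∧ L ≠ N := by
    by_contra! hall
    refine hcard (le_antisymm ?_ hR.two_le_encard_maximalIdeals)
    refine (Set.encard_le_encard (t := {M, N}) fun L hL => ?_).trans
      ((Set.encard_insert_le _ _).trans (by rw [Set.encard_singleton, one_add_one_eq_two]))
    by_cases hLM : L = M
    exacts [Or.inl hLM, Or.inr (hall L hL hLM)]
  have hLM' := hL.not_le_of_ne hM hLM
  have hLN' := hL.not_le_of_ne hN hLN
  rcases hR.eq_or_eq_of_isCoprime hL.ne_top hcop hP.1 hM.isPrime hQ.1 hN.isPrime le_rfl hPM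
    le_rfl hQN (fun h => hLM' (h.trans hPM)) hLM' (fun h => hLN' (h.trans hQN)) hLN' with h | h
  · exact hP.2 (h ▸ hM)
  · exact hQ.2 (h ▸ hN)

/-- Given three such maximal ideals, the chain property yields one non-maximal prime Q contained in
none of them. One serves as L; Q and the product of the other two are comaximal. -/
theorem encard_maximalIdeals_not_le (hR : IsMaximalNonValuativeDomain R) :
    {M ∈ maximalIdeals R | ¬ ∀ P ∈ nonMaximalPrimes R, P ≤ M}.encard ≤ 2 := by
  by_contra! h
  have hchain := hR.isChain_nonMaximalPrimes fun h2 => by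
    have := h.trans_le (Set.encard_le_encard (Set.sep_subset _ _))
    rw [h2] at this
    exact lt_irrefl _ this
  obtain ⟨f, hf, hmem⟩ := Set.exists_injective_fin_of_le_encard (n := 3)
    (Order.add_one_le_of_lt h)
  have hmax : ∀ i, (f i).IsMaximal := fun i => (hmem i).1
  have hex : ∀ i, ∃ P ∈ nonMaximalPrimes R, ¬ P ≤ f i := fun i => by
    simpa using (hmem i).2
  choose P hP hPf using hex
  obtain ⟨Q, hQ, hQf⟩ : ∃ Q ∈ nonMaximalPrimes R, ∀ i, ¬ Q ≤ f i := by
    obtain ⟨Q, hQ, h01⟩ : ∃ Q ∈ nonMaximalPrimes R, P 0 ≤ Q ∧ P 1 ≤ Q :=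
      (hchain.total (hP 0) (hP 1)).elim (fun h => ⟨_, hP 1, h, le_rfl⟩)
        (fun h => ⟨_, hP 0, le_rfl, h⟩)
    obtain ⟨Q', hQ', h2⟩ : ∃ Q' ∈ nonMaximalPrimes R, Q ≤ Q' ∧ P 2 ≤ Q' :=
      (hchain.total hQ (hP 2)).elim (fun h => ⟨_, hP 2, h, le_rfl⟩)
        (fun h => ⟨_, hQ, le_rfl, h⟩)
    refine ⟨Q', hQ', fun i hle => hPf i (le_trans ?_ hle)⟩
    fin_cases i
    exacts [h01.1.trans h2.1, h01.2.trans h2.1, h2.2]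
  obtain ⟨M, hM, hQM⟩ := Ideal.exists_le_maximal Q hQ.1.ne_top
  have hfM : ∀ i, f i ≠ M := fun i h => hQf i (h ▸ hQM)
  have hcop : ∀ i, IsCoprime Q (f i) := fun i => Ideal.isCoprime_of_forall_isMaximal
    fun N hN hQN hfN => hQf i ((hmax i).eq_of_le hN.ne_top hfN ▸ hQN)
  have hnle : ∀ i j, i ≠ j → ¬ f i ≤ f j := fun i j hij =>
    (hmax i).not_le_of_ne (hmax j) (hf.ne hij)
  have hnM := (hmax 0).not_le_of_ne hM (hfM 0)
  rcases hR.eq_or_eq_of_isCoprime (hmax 0).ne_top ((hcop 1).mul_right (hcop 2)) hQ.1 hM.isPrime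
    (hmax 1).isPrime (hmax 2).isPrime le_rfl hQM Ideal.mul_le_left Ideal.mul_le_right
    (fun h => hnM (h.trans hQM)) hnM (hnle 0 1 (by decide)) (hnle 0 2 (by decide)) with h | h
  · exact hQ.2 (h ▸ hM)
  · exact absurd (hf h) (by decide)

/-- If `M` and `N` are the only maximal ideals, then below `M` there is at most one non-maximal
prime that is incomparable with some non-maximal prime below `N`. -/
theorem eq_of_not_le_of_le (hR : IsMaximalNonValuativeDomain R) {M N P P' Q : Ideal R}
    (hM : M.IsMaximal) (hN : N.IsMaximal) (hMN : M ≠ N)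
    (hall : ∀ L : Ideal R, L.IsMaximal → L = M ∨ L = N) (hP : P ∈ nonMaximalPrimes R)
    (hP' : P' ∈ nonMaximalPrimes R) (hQ : Q ∈ nonMaximalPrimes R) (hPM : P ≤ M) (hP'M : P' ≤ M)
    (hQN : Q ≤ N) (hPN : ¬ P ≤ N) (hP'N : ¬ P' ≤ N) (hQM : ¬ Q ≤ M) : P = P' := by
  wlog hle : P ≤ P' generalizing P P'
  · exact (this hP' hP hP'M hPM hP'N hPN
      ((hR.isLocallyValuation.le_total_of_le hM hP.1 hP'.1 hPM hP'M).resolve_left hle)).symm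
  have hcop : IsCoprime P Q := Ideal.isCoprime_of_forall_isMaximal fun L hL h1 h2 => by
    rcases hall L hL with rfl | rfl
    exacts [hQM h2, hPN h1]
  have hMP' : ¬ M ≤ P' := fun h => hP'.2 (le_antisymm h hP'M ▸ hM)
  have hMN' := hM.not_le_of_ne hN hMN
  -- Here L is M itself: it is not contained in the non-maximal primes P ≤ P' over P, nor in Q ≤ N
  -- over Q.
  rcases hR.eq_or_eq_of_isCoprime hM.ne_top hcop hP.1 hP'.1 hQ.1 hN.isPrime le_rfl hle le_rfl hQN
    (fun h => hMP' (h.trans hle)) hMP' (fun h => hMN' (h.trans hQN)) hMN' with h | h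
  · exact h
  · exact absurd (h ▸ hN) hQ.2

theorem exists_unique_incomparable_nonMaximalPrimes (hR : IsMaximalNonValuativeDomain R)
    (hcard : (maximalIdeals R).encard = 2) :
    ∃ P ∈ nonMaximalPrimes R, ∃ Q ∈ nonMaximalPrimes R,
      (¬ P ≤ Q ∧ ¬ Q ≤ P) ∧
      ∀ P' ∈ nonMaximalPrimes R, ∀ Q' ∈ nonMaximalPrimes R,
        (¬ P' ≤ Q' ∧ ¬ Q' ≤ P') → (P' = P ∧ Q' = Q) ∨ (P' = Q ∧ Q' = P) := by
  obtain ⟨M₀, N₀, -, heq⟩ := Set.encard_eq_two.1 hcard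
  have hall₀ : ∀ L : Ideal R, L.IsMaximal → L = M₀ ∨ L = N₀ := fun L hL => by
    have : L ∈ maximalIdeals R := hL
    rwa [heq] at this
  obtain ⟨I, J, P₁, P₂, Q₁, Q₂, hIJ, ⟨hP₁, hP₂, hI₁, hI₂, hP⟩, ⟨hQ₁, hQ₂, hJ₁, hJ₂, hQ⟩⟩ :=
    hR.isLocallyValuation.exists_isCoprime_of_not_isValuativeDomain hR.2.1
  have hno : ∀ L : Ideal R, L.IsMaximal → I ≤ L → ¬ J ≤ L := fun L hL h1 h2 =>
    hL.ne_top (top_le_iff.1 (Ideal.isCoprime_iff_sup_eq.1 hIJ ▸ sup_le h1 h2))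
  -- the maximal ideals can be named so that `I ≤ M` and `J ≤ N`
  obtain ⟨M, N, hM, hN, hMN, hall, hIM, hJN⟩ : ∃ M N : Ideal R, M.IsMaximal ∧ N.IsMaximal ∧
      M ≠ N ∧ (∀ L : Ideal R, L.IsMaximal → L = M ∨ L = N) ∧ I ≤ M ∧ J ≤ N := by
    obtain ⟨M, hM, hPM⟩ := Ideal.exists_le_maximal P₁ hP₁.ne_top
    obtain ⟨N, hN, hQN⟩ := Ideal.exists_le_maximal Q₁ hQ₁.ne_top
    have hIM := hI₁.trans hPM
    have hJN := hJ₁.trans hQN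
    have hMN : M ≠ N := by
      rintro rfl
      exact hno M hM hIM hJN
    refine ⟨M, N, hM, hN, hMN, fun L hL => ?_, hIM, hJN⟩
    rcases hall₀ M hM with rfl | rfl <;> rcases hall₀ N hN with rfl | rfl <;>
      rcases hall₀ L hL with rfl | rfl <;> tauto
  have hJM := hno M hM hIM
  have hIN : ¬ I ≤ N := fun h => hno N hN h hJN
  -- All primes over C lie below M only, so of two distinct ones at most one is maximal. Stated for
  -- general M and N to serve both I and J.
  have hlt : ∀ {A B M N : Ideal R}, (∀ L : Ideal R, L.IsMaximal → L = M ∨ L = N) →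
      ∀ {C : Ideal R}, ¬ C ≤ N → A.IsPrime → B.IsPrime → C ≤ A → C ≤ B → A ≠ B →
      ∃ P ∈ nonMaximalPrimes R, P ≤ M ∧ ¬ P ≤ N := by
    intro A B M N hall C hCN hA hB hCA hCB hAB
    have hle : ∀ D : Ideal R, D.IsPrime → C ≤ D → D ≤ M := by
      intro D hD hCD
      obtain ⟨L, hL, hDL⟩ := Ideal.exists_le_maximal D hD.ne_top
      rcases hall L hL with rfl | rfl
      exacts [hDL, absurd (hCD.trans hDL) hCN]
    by_cases hAmax : A.IsMaximal
    · refine ⟨B, ⟨hB, fun hBmax => hAB ?_⟩, hle B hB hCB, fun h => hCN (hCB.trans h)⟩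
      rcases hall A hAmax with rfl | rfl
      · exact (hBmax.eq_of_le hA.ne_top (hle B hB hCB)).symm
      · exact absurd hCA hCN
    · exact ⟨A, ⟨hA, hAmax⟩, hle A hA hCA, fun h => hCN (hCA.trans h)⟩
  have hall' : ∀ L : Ideal R, L.IsMaximal → L = N ∨ L = M := fun L hL => (hall L hL).symm
  obtain ⟨P, hPmem, hPM, hPN⟩ := hlt hall hIN hP₁ hP₂ hI₁ hI₂ hP
  obtain ⟨Q, hQmem, hQN, hQM⟩ := hlt hall' hJM hQ₁ hQ₂ hJ₁ hJ₂ hQ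
  refine ⟨P, hPmem, Q, hQmem, ⟨fun h => hPN (h.trans hQN), fun h => hQM (h.trans hPM)⟩, ?_⟩
  intro P' hP' Q' hQ' h
  -- Comaximal P' and Q' lie below different maximal ideals, which decides the order in which they
  -- match P and Q.
  have hcop := Ideal.isCoprime_iff_sup_eq.1 (hR.isCoprime_of_not_le hP'.1 hQ'.1 h.1 h.2)
  have hno' : ∀ L : Ideal R, L.IsMaximal → P' ≤ L → ¬ Q' ≤ L := fun L hL h1 h2 =>
    hL.ne_top (top_le_iff.1 (hcop ▸ sup_le h1 h2))
  have hbelow : ∀ D : Ideal R, D.IsPrime → D ≤ M ∨ D ≤ N := fun D hD => by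
    obtain ⟨L, hL, hDL⟩ := Ideal.exists_le_maximal D hD.ne_top
    rcases hall L hL with rfl | rfl
    exacts [Or.inl hDL, Or.inr hDL]
  have hnoM := hno' M hM
  have hnoN := hno' N hN
  rcases hbelow P' hP'.1 with hP'M | hP'N
  · left
    have hQ'M := hnoM hP'M
    have hQ'N := (hbelow Q' hQ'.1).resolve_left hQ'M
    have hP'N : ¬ P' ≤ N := fun h => hnoN h hQ'N
    exact ⟨hR.eq_of_not_le_of_le hM hN hMN hall hP' hPmem hQmem hP'M hPM hQN hP'N hPN hQM,
      hR.eq_of_not_le_of_le hN hM hMN.symm hall' hQ' hQmem hPmem hQ'N hQN hPM hQ'M hQM hPN⟩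
  · right
    have hQ'N := hnoN hP'N
    have hQ'M := (hbelow Q' hQ'.1).resolve_right hQ'N
    have hP'M : ¬ P' ≤ M := fun h => hnoM h hQ'M
    exact ⟨hR.eq_of_not_le_of_le hN hM hMN.symm hall' hP' hQmem hPmem hP'N hQN hPM hP'M hQM hPN,
      hR.eq_of_not_le_of_le hM hN hMN hall hQ' hPmem hQmem hQ'M hPM hQN hQ'N hPN hQM⟩

end IsMaximalNonValuativeDomain

theorem proposition2p8 (R : Type*) [CommRing R] [IsDomain R] [IsIntegrallyClosed R]
    (hR : IsMaximalNonValuativeDomain R) :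
    (2 ≤ (maximalIdeals R).encard ∧ (maximalIdeals R).encard ≤ 4) ∧
    ((maximalIdeals R).encard = 2 →
      ∃ P ∈ nonMaximalPrimes R, ∃ Q ∈ nonMaximalPrimes R,
        (¬ P ≤ Q ∧ ¬ Q ≤ P) ∧
        ∀ P' ∈ nonMaximalPrimes R, ∀ Q' ∈ nonMaximalPrimes R,
          (¬ P' ≤ Q' ∧ ¬ Q' ≤ P') → (P' = P ∧ Q' = Q) ∨ (P' = Q ∧ Q' = P)) ∧
    ((maximalIdeals R).encard ≠ 2 → IsChain (· ≤ ·) (nonMaximalPrimes R)) ∧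
    {M ∈ maximalIdeals R | ¬ ∀ P ∈ nonMaximalPrimes R, P ≤ M}.encard ≤ 2 :=
  ⟨⟨hR.two_le_encard_maximalIdeals, hR.encard_maximalIdeals_le_four⟩,
    hR.exists_unique_incomparable_nonMaximalPrimes, hR.isChain_nonMaximalPrimes,
    hR.encard_maximalIdeals_not_le⟩
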